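/- Let $\square=[-\pi,\pi)^2$ and $\square^*=[-\tfrac12,\tfrac12)^2$, and let $R\subset\mathbb{R}^2$ be a non-empty open set with $\overline R\subset\square$. Let $H^1_{per}(\square;\mathbb{C}^2)$ be the space of fields $w:\mathbb{R}^2\to\mathbb{C}^2$ that are $2\pi$-periodic in each variable and belong to $H^1_{loc}(\mathbb{R}^2;\mathbb{C}^2)$. For $\theta\in\square^*$ put $$H^1_\theta(\square;\mathbb{C}^2)=\{e^{\mathrm{i}\theta\cdot y}w(y)\;:\;w\in H^1_{per}(\square;\mathbb{C}^2)\},$$ $$V(\theta)=\{v\in H^1_\theta(\square;\mathbb{C}^2)\;:\;\partial_1v_1+\partial_2v_2=0\ \text{ and }\ \partial_1v_2-\partial_2v_1=0\ \text{ a.e. in }\square\setminus R\},$$ and let $\|v\|_{H^1(\square;\mathbb{C}^2)}^2=\sum_{k}\int_\square|v_k|^2+\sum_{j,k}\int_\square|\partial_jv_k|^2$, with weak derivatives throughout. Theorem (Lipschitz continuity of $V(\theta)$). There is a constant $L_V>0$ (depending only on $R$) such that for all $\theta,\theta'\in\square^*$ and all $v\in V(\theta)$ $$\inf_{v'\in V(\theta')}\|v-v'\|_{H^1(\square;\mathbb{C}^2)}\le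 L_V\,|\theta-\theta'|\,\|v\|_{H^1(\square;\mathbb{C}^2)}.$$ -/

import Mathlib

open Set MeasureTheory
open scoped ContDiff

noncomputable section

/-- The Euclidean plane, in which both positions and quasi-momenta live. -/
abbrev Plane : Type := EuclideanSpace ℝ (Fin 2)

/-- The periodic reference cell `[-π, π)²`. -/
def cell : Set Plane := {y | ∀ j, y j ∈ Ico (-Real.pi) Real.pi}

/-- The dual cell `[-1/2, 1/2)²` of quasi-momenta. -/
def dualCell : Set Plane := {θ | ∀ j, θ j ∈ Ico (-(1 / 2) : ℝ) (1 / 2)}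

/-- `g` is the weak partial derivative `∂u/∂y_j` on the open set `Ω`: one integrates by parts against
every smooth test function with compact support contained in `Ω`. (It is used for `u`, `g` that are
square integrable on `Ω`, so that both integrals converge.) -/
def IsWeakPartial (Ω : Set Plane) (j : Fin 2) (u g : Plane → ℂ) : Prop :=
  ∀ φ : Plane → ℂ, ContDiff ℝ ∞ φ → HasCompactSupport φ → tsupport φ ⊆ Ω →
    ∫ y in Ω, u y * fderiv ℝ φ y (EuclideanSpace.single j 1) = -∫ y in Ω, g y * φ y

/-- `g` is square integrable on `Ω` and is the weak partial derivative `∂u/∂y_j` on `Ω`. -/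
def IsL2WeakPartial (Ω : Set Plane) (j : Fin 2) (u g : Plane → ℂ) : Prop :=
  MemLp g 2 (volume.restrict Ω) ∧ IsWeakPartial Ω j u g

/-- The Sobolev space `H¹(Ω)` of the open set `Ω`: `u` and its weak partial derivatives are square
integrable on `Ω`. -/
def MemH1 (Ω : Set Plane) (u : Plane → ℂ) : Prop :=
  MemLp u 2 (volume.restrict Ω) ∧ ∀ j, ∃ g, IsL2WeakPartial Ω j u g

open Classical in
/-- The weak partial derivative `∂u/∂y_j` on the reference cell (well defined up to a null set of the
cell for `u` in `H¹`, and `0` by convention if there is none). The cell differs from its interior by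
a null set. -/
def weakPartial (j : Fin 2) (u : Plane → ℂ) : Plane → ℂ :=
  if h : ∃ g, IsL2WeakPartial (interior cell) j u g then h.choose else 0

/-- The divergence `∂₁u₁ + ∂₂u₂` on the cell. -/
def weakDiv (u : Plane → Fin 2 → ℂ) (y : Plane) : ℂ :=
  weakPartial 0 (fun x => u x 0) y + weakPartial 1 (fun x => u x 1) y

/-- The two-dimensional curl `∂₁u₂ - ∂₂u₁` on the cell. -/
def weakCurl (u : Plane → Fin 2 → ℂ) (y : Plane) : ℂ :=
  weakPartial 0 (fun x => u x 1) y - weakPartial 1 (fun x => u x 0) y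

/-- The standard norm of `H¹(□; ℂ²)`, where `□` is the cell:
`‖u‖² = ∑ₖ (∫_□ |uₖ|² + ∑ⱼ ∫_□ |∂ⱼuₖ|²)`. -/
def h1Norm (u : Plane → Fin 2 → ℂ) : ℝ :=
  Real.sqrt (∑ k, ((∫ y in cell, ‖u y k‖ ^ 2) +
    ∑ j, ∫ y in cell, ‖weakPartial j (fun x => u x k) y‖ ^ 2))

/-- `H¹_per(□; ℂ²)`: fields on the plane that are `2π`-periodic in both variables and whose components
are locally of class `H¹` on the whole plane. -/
def H1Per : Set (Plane → Fin 2 → ℂ) :=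
  {w | (∀ j y, w (y + EuclideanSpace.single j (2 * Real.pi)) = w y) ∧
    ∀ k, ∀ Ω : Set Plane, IsOpen Ω → Bornology.IsBounded Ω → MemH1 Ω (fun y => w y k)}

/-- `H¹_θ(□; ℂ²)`: the `θ`-quasi-periodic fields `e^{iθ·y} w(y)` with `w` in `H¹_per(□; ℂ²)`. -/
def H1Quasi (θ : Plane) : Set (Plane → Fin 2 → ℂ) :=
  {v | ∃ w ∈ H1Per, ∀ y k, v y k = Complex.exp (Complex.I * (inner ℝ θ y : ℝ)) * w y k}

/-- The space `V(θ)` for the inclusion `R`: the fields in `H¹_θ(□; ℂ²)` whose divergence and curl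
vanish (almost everywhere) in `□ \ R`. -/
def VSpace (R : Set Plane) (θ : Plane) : Set (Plane → Fin 2 → ℂ) :=
  {v | v ∈ H1Quasi θ ∧ (∀ᵐ y ∂volume.restrict (cell \ R), weakDiv v y = 0) ∧
    ∀ᵐ y ∂volume.restrict (cell \ R), weakCurl v y = 0}

end

/-!
A field `v = e^{iθ·y}w` of `V(θ)` is compared with `v' = e^{iθ'·y}(w + δ)`, where `w` is the
periodic part of `v` and `δ` is a small periodic correction. Outside `R`, the field `v'` is free
of divergence and curl as soon as `(∇ + iθ')·δ = i(θ - θ')·w` and `(∇ + iθ')×δ = i(θ - θ')×w`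
there, and inside `R` the sources may be chosen freely. The freedom is used to subtract the mean
values of the sources (`exists_meanZero_correction`): this removes the only resonant mode `k = 0`,
the one at which the symbol `i(k + θ')` of the twisted gradient may degenerate. On the other modes
`|k + θ'| ≥ 1/2` for all `θ'` in the dual cell (`quarter_le_sq_add_sq`), so the system is solved
by bounded Fourier multipliers, with a uniform bound of `δ` in `H¹` by the `L²` norm of the
sources (`exists_periodic_divCurl`). These are of size `|θ - θ'| ‖w‖`, as is the error made by
changing the phase from `e^{iθ·y}` to `e^{iθ'·y}` on the bounded cell.

Fourier series live on Mathlib's torus `(ℝ/ℤ)²`. Its `L²` space is identified with `L²(□)` through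
the covering map `toTorus`, and the weak derivatives of pulled back series are computed termwise
(`isL2WeakPartial_toTorus`).
-/

noncomputable section

/-! ### The reference cell -/

lemma norm_le_of_mem_cell {y : Plane} (hy : y ∈ cell) : ‖y‖ ≤ 2 * Real.pi := by
  have h : ∀ j, y j ^ 2 ≤ Real.pi ^ 2 := fun j => sq_le_sq' (hy j).1 (hy j).2.le
  rw [EuclideanSpace.norm_eq, Fin.sum_univ_two]
  refine Real.sqrt_le_iff.2 ⟨by positivity, ?_⟩
  simp only [Real.norm_eq_abs, sq_abs]
  nlinarith [h 0, h 1, sq_nonneg Real.pi]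

lemma isBounded_cell : Bornology.IsBounded cell :=
  (Metric.isBounded_closedBall (x := (0 : Plane)) (r := 2 * Real.pi)).subset fun _ hy =>
    mem_closedBall_zero_iff.2 (norm_le_of_mem_cell hy)

lemma measurableSet_cell : MeasurableSet cell := by
  have : cell = ⋂ j, (fun y : Plane => y j) ⁻¹' Ico (-Real.pi) Real.pi := by
    ext; simp [cell]
  rw [this]
  exact MeasurableSet.iInter fun j => (by fun_prop : Measurable fun y : Plane => y j) measurableSet_Ico

section Torus

/-- The circle is normalised to total mass one, as in Mathlib's multivariate Fourier series. -/
local instance : MeasureSpace UnitAddCircle := ⟨AddCircle.haarAddCircle⟩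

local instance : Measure.IsAddHaarMeasure (volume : Measure UnitAddCircle) :=
  inferInstanceAs (Measure.IsAddHaarMeasure AddCircle.haarAddCircle)

local instance : IsProbabilityMeasure (volume : Measure UnitAddCircle) :=
  inferInstanceAs (IsProbabilityMeasure AddCircle.haarAddCircle)

local notation "TorusL2" => Lp ℂ 2 (volume : Measure (UnitAddTorus (Fin 2)))

/-! ### The covering of the torus by the plane -/

/-- The half-open period box `∏ⱼ (aⱼ, aⱼ + 2π]`. The cell is such a box up to a null set;
intervals closed on the right match the fundamental domains of `AddCircle` in Mathlib. -/
def periodBox (a : Fin 2 → ℝ) : Set Plane := {y | ∀ j, y j ∈ Ioc (a j) (a j + 2 * Real.pi)}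

/-- The covering map `ℝ² → (ℝ/ℤ)²`, rescaled so that its fibres are the orbits of `2πℤ²`. -/
def toTorus (y : Plane) : UnitAddTorus (Fin 2) := fun j => ((y j / (2 * Real.pi) : ℝ) : UnitAddCircle)

lemma measurable_toTorus : Measurable toTorus := by
  refine measurable_pi_lambda _ fun j => AddCircle.measurable_mk'.comp ?_
  fun_prop

lemma measurableSet_periodBox (a : Fin 2 → ℝ) : MeasurableSet (periodBox a) := by
  have : periodBox a = ⋂ j, (fun y : Plane => y j) ⁻¹' Ioc (a j) (a j + 2 * Real.pi) := by
    ext; simp [periodBox]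
  rw [this]
  exact MeasurableSet.iInter fun j => (by fun_prop : Measurable fun y : Plane => y j) measurableSet_Ioc

/-- The covering map preserves measure on each period box, up to the area `(2π)²`, since the torus
has total mass one. -/
lemma map_toTorus_periodBox (a : Fin 2 → ℝ) :
    Measure.map toTorus (volume.restrict (periodBox a)) =
      ENNReal.ofReal ((2 * Real.pi) ^ 2) • (volume : Measure (UnitAddTorus (Fin 2))) := by
  have hπ : (0 : ℝ) < 2 * Real.pi := by positivity
  let b : Fin 2 → ℝ := fun j => a j / (2 * Real.pi)
  let B : Set (Fin 2 → ℝ) := Set.pi univ fun j => Ioc (b j) (b j + 1)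
  have hB : MeasurableSet B := MeasurableSet.univ_pi fun _ => measurableSet_Ioc
  have h1 : MeasurePreserving (fun (x : Fin 2 → ℝ) (j : Fin 2) => (x j : UnitAddCircle))
      (volume.restrict B) volume := by
    have := measurePreserving_pi _ _ (fun j : Fin 2 => AddCircle.measurePreserving_mk 1 (b j))
    convert! this
    · exact Measure.restrict_pi_pi (fun _ => volume) _
    · simp [volume, AddCircle.haarAddCircle]
  let S : (Fin 2 → ℝ) → (Fin 2 → ℝ) := fun x => (2 * Real.pi)⁻¹ • x
  have hS : Measurable S := by fun_prop
  let O : Plane → (Fin 2 → ℝ) := WithLp.ofLp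
  have hO : MeasurePreserving O volume volume := PiLp.volume_preserving_ofLp (Fin 2)
  have hbox : periodBox a = (S ∘ O) ⁻¹' B := by
    ext y
    simp only [periodBox, mem_ofPred_eq, mem_preimage, B, S, O, Function.comp, mem_univ_pi, b,
      Pi.smul_apply, smul_eq_mul, mem_Ioc]
    refine forall_congr' fun j => ?_
    rw [div_lt_iff₀ hπ, ← div_eq_inv_mul, div_mul_cancel₀ _ hπ.ne', div_le_iff₀ hπ, add_mul,
      div_mul_cancel₀ _ hπ.ne', one_mul]
  have hSv : Measure.map S volume = ENNReal.ofReal ((2 * Real.pi) ^ 2) • volume := by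
    rw [Measure.map_addHaar_smul _ (inv_ne_zero hπ.ne')]
    congr 2
    rw [Module.finrank_fin_fun, abs_of_pos (by positivity), inv_pow, inv_inv]
  have hcomp : toTorus = (fun (x : Fin 2 → ℝ) (j : Fin 2) => (x j : UnitAddCircle)) ∘ (S ∘ O) := by
    ext y j
    simp [toTorus, S, O, div_eq_inv_mul]
  rw [hcomp, ← Measure.map_map h1.measurable (hS.comp hO.measurable), hbox,
    ← Measure.restrict_map (hS.comp hO.measurable) hB, ← Measure.map_map hS hO.measurable,
    hO.map_eq, hSv, Measure.restrict_smul, Measure.map_smul, h1.map_eq]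

lemma cell_ae_eq_periodBox : cell =ᵐ[volume] periodBox fun _ => -Real.pi := by
  have hO := PiLp.volume_preserving_ofLp (Fin 2)
  have h : (Set.pi univ fun _ : Fin 2 => Ico (-Real.pi) Real.pi) =ᵐ[volume]
      (Set.pi univ fun _ : Fin 2 => Ioc (-Real.pi) Real.pi) :=
    (Measure.univ_pi_Ico_ae_eq_Icc (μ := fun _ : Fin 2 => (volume : Measure ℝ))).trans
      (Measure.univ_pi_Ioc_ae_eq_Icc (μ := fun _ : Fin 2 => (volume : Measure ℝ))).symm
  have := hO.quasiMeasurePreserving.preimage_ae_eq h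
  have h1 : cell = (WithLp.ofLp : Plane → _) ⁻¹' univ.pi fun _ => Ico (-Real.pi) Real.pi := by
    ext; simp [cell]
  have h2 : (periodBox fun _ => -Real.pi) =
      (WithLp.ofLp : Plane → _) ⁻¹' univ.pi fun _ => Ioc (-Real.pi) Real.pi := by
    ext; simp [periodBox, show -Real.pi + 2 * Real.pi = Real.pi by ring]
  rwa [h1, h2]

lemma map_toTorus_cell : Measure.map toTorus (volume.restrict cell) =
      ENNReal.ofReal ((2 * Real.pi) ^ 2) • (volume : Measure (UnitAddTorus (Fin 2))) := by
  rw [Measure.restrict_congr_set cell_ae_eq_periodBox, map_toTorus_periodBox]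

/-- A bounded set meets finitely many period boxes, so its image measure on the torus is dominated
by a multiple of Haar measure. Hence pullbacks from the torus are locally square integrable. -/
lemma exists_map_toTorus_le {Ω : Set Plane} (hΩ : Bornology.IsBounded Ω) :
    ∃ M : ENNReal, M ≠ ⊤ ∧ Measure.map toTorus (volume.restrict Ω) ≤
      M • (volume : Measure (UnitAddTorus (Fin 2))) := by
  have hπ : (0 : ℝ) < 2 * Real.pi := by positivity
  obtain ⟨r, hr⟩ := hΩ.subset_closedBall 0
  obtain ⟨N, hN⟩ := exists_nat_ge r
  let F : Finset (Fin 2 → ℤ) := Fintype.piFinset fun _ => Finset.Icc (-(N : ℤ) - 1) N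
  have hcov : Ω ⊆ ⋃ n ∈ F, periodBox fun j => 2 * Real.pi * n j := by
    intro y hy
    have hy' : ∀ j, |y j| ≤ N := fun j => by
      have h1 := hr hy
      rw [mem_closedBall_zero_iff] at h1
      exact ((PiLp.norm_apply_le y j).trans h1).trans hN
    have h2 : (1 : ℝ) ≤ 2 * Real.pi := by linarith [Real.pi_gt_three]
    refine mem_iUnion₂.2 ⟨fun j => ⌈y j / (2 * Real.pi)⌉ - 1, ?_, fun j => ?_⟩
    · refine Fintype.mem_piFinset.2 fun j => Finset.mem_Icc.2 ⟨?_, ?_⟩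
      · have : -(N : ℤ) ≤ ⌈y j / (2 * Real.pi)⌉ := by
          rw [Int.le_ceil_iff]
          push_cast
          rw [lt_div_iff₀ hπ]
          nlinarith [(abs_le.1 (hy' j)).1, (Nat.cast_nonneg N : (0 : ℝ) ≤ N)]
        linarith
      · have : ⌈y j / (2 * Real.pi)⌉ ≤ (N : ℤ) := by
          rw [Int.ceil_le, div_le_iff₀ hπ]
          push_cast
          nlinarith [(abs_le.1 (hy' j)).2, (Nat.cast_nonneg N : (0 : ℝ) ≤ N)]
        linarith
    · have h3 := Int.ceil_lt_add_one (y j / (2 * Real.pi))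
      have h4 := Int.le_ceil (y j / (2 * Real.pi))
      rw [div_le_iff₀ hπ] at h4
      rw [← sub_lt_iff_lt_add, lt_div_iff₀ hπ] at h3
      push_cast
      constructor <;> nlinarith
  refine ⟨F.card * ENNReal.ofReal ((2 * Real.pi) ^ 2), by finiteness, ?_⟩
  have hres : volume.restrict Ω ≤ ∑ n ∈ F, volume.restrict (periodBox fun j => 2 * Real.pi * n j) := by
    refine (Measure.restrict_mono hcov le_rfl).trans ?_
    rw [← Measure.sum_coe_finset]
    exact Measure.restrict_biUnion_le F.countable_toSet
  calc Measure.map toTorus (volume.restrict Ω)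
      ≤ Measure.map toTorus (∑ n ∈ F, volume.restrict (periodBox fun j => 2 * Real.pi * n j)) :=
        Measure.map_mono hres measurable_toTorus
    _ = ∑ n ∈ F, Measure.map toTorus (volume.restrict (periodBox fun j => 2 * Real.pi * n j)) := by
        simpa [Measure.mapₗ_apply_of_measurable measurable_toTorus] using
          map_sum (Measure.mapₗ toTorus)
            (fun n : Fin 2 → ℤ =>
              (volume : Measure Plane).restrict (periodBox fun j => 2 * Real.pi * n j)) F
    _ = _ := by
        simp_rw [map_toTorus_periodBox]
        rw [Finset.sum_const, mul_smul, ← Nat.cast_smul_eq_nsmul ENNReal]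

/-- The measurable section of `toTorus` with values in the box `(-π, π]²`. -/
def ofTorus (x : UnitAddTorus (Fin 2)) : Plane :=
  WithLp.toLp 2 fun j => 2 * Real.pi * (AddCircle.measurableEquivIoc 1 (-(1 / 2)) (x j) : ℝ)

lemma measurable_ofTorus : Measurable ofTorus := by
  refine (WithLp.measurable_toLp 2 _).comp (measurable_pi_lambda _ fun j => ?_)
  refine Measurable.const_mul (measurable_subtype_coe.comp
    ((MeasurableEquiv.measurable _).comp (measurable_pi_apply j))) _

lemma ofTorus_toTorus {y : Plane} (hy : y ∈ periodBox fun _ => -Real.pi) :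
    ofTorus (toTorus y) = y := by
  have hπ : (0 : ℝ) < 2 * Real.pi := by positivity
  ext j
  have h : y j / (2 * Real.pi) ∈ Ioc (-(1 / 2) : ℝ) (-(1 / 2) + 1) := by
    have := hy j
    simp only [mem_Ioc] at this
    rw [mem_Ioc, lt_div_iff₀ hπ, div_le_iff₀ hπ]
    constructor <;> linarith
  have h2 : AddCircle.measurableEquivIoc 1 (-(1 / 2)) ((y j / (2 * Real.pi) : ℝ) : UnitAddCircle) =
      (⟨_, h⟩ : Ioc _ _) := Subtype.ext (AddCircle.equivIoc_coe_of_mem h)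
  simp only [ofTorus, toTorus, h2]
  field_simp

lemma ofTorus_toTorus_ae : ∀ᵐ y ∂volume.restrict cell, ofTorus (toTorus y) = y := by
  rw [Measure.restrict_congr_set cell_ae_eq_periodBox]
  filter_upwards [ae_restrict_mem (measurableSet_periodBox _)] with y hy using ofTorus_toTorus hy

lemma map_ofTorus : ENNReal.ofReal ((2 * Real.pi) ^ 2) • Measure.map ofTorus volume =
    volume.restrict cell := by
  rw [← Measure.map_smul, ← map_toTorus_cell, Measure.map_map measurable_ofTorus measurable_toTorus]
  exact (Measure.map_congr ofTorus_toTorus_ae).trans Measure.map_id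

/-! ### Plane waves -/

/-- The plane wave `y ↦ e^{iθ·y}`. -/
def phase (θ y : Plane) : ℂ := Complex.exp (Complex.I * (inner ℝ θ y : ℝ))

lemma norm_phase (θ y : Plane) : ‖phase θ y‖ = 1 := by
  rw [phase, mul_comm, Complex.norm_exp_ofReal_mul_I]

lemma contDiff_phase (θ : Plane) {n : WithTop ℕ∞} : ContDiff ℝ n (phase θ) := by
  exact (contDiff_const.mul (Complex.ofRealCLM.contDiff.comp (innerSL ℝ θ).contDiff)).cexp

lemma fderiv_phase (θ y : Plane) (j : Fin 2) :
    fderiv ℝ (phase θ) y (EuclideanSpace.single j 1) = Complex.I * θ j * phase θ y := by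
  have h : HasFDerivAt (phase θ) _ y :=
    ((Complex.ofRealCLM.hasFDerivAt.comp y (innerSL ℝ θ).hasFDerivAt).const_mul Complex.I).cexp
  rw [h.fderiv]
  simp [phase, EuclideanSpace.inner_single_right]
  ring

lemma mFourier_toTorus (k : Fin 2 → ℤ) (y : Plane) :
    UnitAddTorus.mFourier k (toTorus y) = phase (WithLp.toLp 2 fun j => (k j : ℝ)) y := by
  have hπ : (Real.pi : ℂ) ≠ 0 := by exact_mod_cast Real.pi_ne_zero
  simp only [UnitAddTorus.mFourier, ContinuousMap.coe_mk, toTorus, fourier_coe_apply, phase,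
    ← Complex.exp_sum]
  congr 1
  simp only [Fin.sum_univ_two, PiLp.inner_apply]
  simp
  field_simp

/-! ### Square integrable functions on the cell and on the torus -/

/-- Almost everywhere statements on the torus pull back to bounded subsets of the plane. -/
lemma ae_toTorus {P : UnitAddTorus (Fin 2) → Prop} (h : ∀ᵐ x, P x) {Ω : Set Plane}
    (hΩ : Bornology.IsBounded Ω) : ∀ᵐ y ∂volume.restrict Ω, P (toTorus y) := by
  obtain ⟨M, -, hM⟩ := exists_map_toTorus_le hΩ
  refine ae_of_ae_map measurable_toTorus.aemeasurable
    ((Measure.absolutelyContinuous_of_le hM).trans Measure.smul_absolutelyContinuous h)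

lemma exists_eLpNorm_comp_toTorus_le {Ω : Set Plane} (hΩ : Bornology.IsBounded Ω) :
    ∃ M : ENNReal, M ≠ ⊤ ∧ ∀ p : UnitAddTorus (Fin 2) → ℂ, MemLp p 2 volume →
      MemLp (p ∘ toTorus) 2 (volume.restrict Ω) ∧
      eLpNorm (p ∘ toTorus) 2 (volume.restrict Ω) ≤ M * eLpNorm p 2 volume := by
  obtain ⟨M, hMt, hM⟩ := exists_map_toTorus_le hΩ
  refine ⟨M ^ (1 / (2 : ENNReal)).toReal, by finiteness, fun p hp => ?_⟩
  have hp' : MemLp p 2 (Measure.map toTorus (volume.restrict Ω)) :=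
    hp.of_measure_le_smul hMt hM
  refine ⟨hp'.comp_of_map measurable_toTorus.aemeasurable, ?_⟩
  rw [← eLpNorm_map_measure hp'.1 measurable_toTorus.aemeasurable]
  refine (eLpNorm_mono_measure _ hM).trans ?_
  rw [eLpNorm_smul_measure_of_ne_top (by simp), smul_eq_mul]

/-- Square integrable functions on the cell are restrictions of pullbacks from the torus. -/
lemma exists_torusL2 {f : Plane → ℂ} (hf : MemLp f 2 (volume.restrict cell)) :
    ∃ q : TorusL2, (fun y => q (toTorus y)) =ᵐ[volume.restrict cell] f := by
  have hc : ENNReal.ofReal ((2 * Real.pi) ^ 2) ≠ 0 := by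
    rw [Ne, ENNReal.ofReal_eq_zero, not_le]; positivity
  have h1 : MemLp f 2 (Measure.map ofTorus volume) := by
    refine hf.of_measure_le_smul (c := (ENNReal.ofReal ((2 * Real.pi) ^ 2))⁻¹) (by simp [hc]) ?_
    rw [← map_ofTorus, smul_smul, ENNReal.inv_mul_cancel hc (by finiteness), one_smul]
  have h2 : MemLp (f ∘ ofTorus) 2 volume := h1.comp_of_map measurable_ofTorus.aemeasurable
  refine ⟨h2.toLp _, ?_⟩
  filter_upwards [ae_toTorus h2.coeFn_toLp isBounded_cell, ofTorus_toTorus_ae] with y hy hy'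
  rw [hy, Function.comp, hy']

/-- The norm of `L²(□)`, with the junk value `0` where the extended norm is infinite. -/
def cellNorm (f : Plane → ℂ) : ℝ := (eLpNorm f 2 (volume.restrict cell)).toReal

lemma cellNorm_toTorus (p : TorusL2) : cellNorm (fun y => p (toTorus y)) = 2 * Real.pi * ‖p‖ := by
  have h : AEStronglyMeasurable p (Measure.map toTorus (volume.restrict cell)) := by
    rw [map_toTorus_cell]
    exact (Lp.aestronglyMeasurable p).smul_measure _
  have := eLpNorm_map_measure (p := 2) h measurable_toTorus.aemeasurable
  rw [cellNorm, show (fun y => p (toTorus y)) = p ∘ toTorus from rfl, ← this, map_toTorus_cell,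
    eLpNorm_smul_measure_of_ne_top (by simp), Lp.norm_def, smul_eq_mul, ENNReal.toReal_mul]
  congr 1
  rw [← ENNReal.toReal_rpow, ENNReal.toReal_ofReal (by positivity), ← Real.rpow_natCast,
    ← Real.rpow_mul (by positivity)]
  simp

lemma mFourierCoeff_zero_of_integral_cell (q : TorusL2) :
    (2 * Real.pi) ^ 2 * UnitAddTorus.mFourierCoeff q 0 = ∫ y in cell, q (toTorus y) := by
  have h : AEStronglyMeasurable q (Measure.map toTorus (volume.restrict cell)) := by
    rw [map_toTorus_cell]
    exact (Lp.aestronglyMeasurable q).smul_measure _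
  rw [← integral_map measurable_toTorus.aemeasurable h, map_toTorus_cell, integral_smul_measure,
    ENNReal.toReal_ofReal (by positivity)]
  simp [UnitAddTorus.mFourierCoeff, UnitAddTorus.mFourier_zero]

/-- Pairing a function on the torus with a test function on the plane is continuous in `L²`. -/
lemma exists_pairing {Ω : Set Plane} (hΩ : Bornology.IsBounded Ω) {ψ : Plane → ℂ}
    (hψ : MemLp ψ 2 (volume.restrict Ω)) :
    ∃ l : TorusL2 →L[ℂ] ℂ, ∀ p : TorusL2, l p = ∫ y in Ω, p (toTorus y) * ψ y := by
  obtain ⟨M, hMt, hM⟩ := exists_eLpNorm_comp_toTorus_le hΩ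
  have hint : ∀ p : TorusL2, Integrable (fun y => p (toTorus y) * ψ y) (volume.restrict Ω) :=
    fun p => (hM p (Lp.memLp p)).1.integrable_mul hψ
  let l : TorusL2 →ₗ[ℂ] ℂ :=
    { toFun := fun p => ∫ y in Ω, p (toTorus y) * ψ y
      map_add' := fun p q => by
        rw [← integral_add (hint p) (hint q)]
        refine integral_congr_ae ?_
        filter_upwards [ae_toTorus (Lp.coeFn_add p q) hΩ] with y hy
        rw [hy, Pi.add_apply, add_mul]
      map_smul' := fun c p => by
        rw [RingHom.id_apply, smul_eq_mul, ← integral_const_mul]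
        refine integral_congr_ae ?_
        filter_upwards [ae_toTorus (Lp.coeFn_smul c p) hΩ] with y hy
        rw [hy, Pi.smul_apply, smul_eq_mul, mul_assoc] }
  refine ⟨l.mkContinuous (M.toReal * (eLpNorm ψ 2 (volume.restrict Ω)).toReal) fun p => ?_,
    fun p => rfl⟩
  have h1 := (hM p (Lp.memLp p)).1
  have h2 : eLpNorm (fun y => p (toTorus y) * ψ y) 1 (volume.restrict Ω) ≤
      M * eLpNorm p 2 volume * eLpNorm ψ 2 (volume.restrict Ω) := by
    refine (eLpNorm_smul_le_mul_eLpNorm (p := 2) (q := 2) (r := 1) hψ.1 h1.1).trans ?_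
    gcongr
    exact (hM p (Lp.memLp p)).2
  have h3 : ‖∫ y in Ω, p (toTorus y) * ψ y‖ ≤
      (eLpNorm (fun y => p (toTorus y) * ψ y) 1 (volume.restrict Ω)).toReal := by
    refine (norm_integral_le_integral_norm _).trans_eq ?_
    rw [integral_norm_eq_lintegral_enorm (hint p).1, eLpNorm_one_eq_lintegral_enorm]
  refine (h3.trans (ENNReal.toReal_mono ?_ h2)).trans_eq ?_
  · exact ENNReal.mul_ne_top (ENNReal.mul_ne_top hMt (Lp.eLpNorm_ne_top p)) hψ.eLpNorm_ne_top
  · rw [ENNReal.toReal_mul, ENNReal.toReal_mul, Lp.norm_def]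
    ring

/-! ### Fourier series: weak derivatives and multipliers -/

lemma setIntegral_mul_fderiv {Ω : Set Plane} {f φ : Plane → ℂ} (hf : ContDiff ℝ ∞ f)
    (hφ : ContDiff ℝ ∞ φ) (hc : HasCompactSupport φ) (hs : tsupport φ ⊆ Ω) (v : Plane) :
    ∫ y in Ω, f y * fderiv ℝ φ y v = -∫ y in Ω, fderiv ℝ f y v * φ y := by
  have hf' : Continuous fun y => fderiv ℝ f y v :=
    (hf.continuous_fderiv (by simp)).clm_apply continuous_const
  have hφ' : Continuous fun y => fderiv ℝ φ y v :=
    (hφ.continuous_fderiv (by simp)).clm_apply continuous_const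
  rw [setIntegral_eq_integral_of_forall_compl_eq_zero,
    setIntegral_eq_integral_of_forall_compl_eq_zero]
  · refine integral_mul_fderiv_eq_neg_fderiv_mul_of_integrable ?_ ?_ ?_ ?_ ?_
    · exact (hf'.mul hφ.continuous).integrable_of_hasCompactSupport hc.mul_left
    · exact (hf.continuous.mul hφ').integrable_of_hasCompactSupport
        (hc.fderiv_apply (𝕜 := ℝ) v).mul_left
    · exact (hf.continuous.mul hφ.continuous).integrable_of_hasCompactSupport hc.mul_left
    · exact fun y _ => (hf.differentiable (by simp)) y
    · exact fun y _ => (hφ.differentiable (by simp)) y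
  · intro y hy
    rw [image_eq_zero_of_notMem_tsupport (fun h => hy (hs h)), mul_zero]
  · intro y hy
    rw [fderiv_of_notMem_tsupport ℝ (fun h => hy (hs h))]
    simp

/-- Termwise differentiation of a Fourier series: if the Fourier coefficients of `g` are `i kⱼ`
times those of `p`, then the periodic function `g` is the weak derivative `∂ⱼp`. Both sides of the
weak formulation are continuous linear functionals on `L²` of the torus, so that it is enough to
integrate by parts against the plane waves. -/
lemma isL2WeakPartial_toTorus {p g : TorusL2} {j : Fin 2}
    (h : ∀ k, UnitAddTorus.mFourierCoeff g k = Complex.I * k j * UnitAddTorus.mFourierCoeff p k)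
    {Ω : Set Plane} (hΩ : Bornology.IsBounded Ω) :
    IsL2WeakPartial Ω j (fun y => p (toTorus y)) (fun y => g (toTorus y)) := by
  obtain ⟨M, -, hM⟩ := exists_eLpNorm_comp_toTorus_le hΩ
  refine ⟨(hM g (Lp.memLp g)).1, fun φ hφ hc hs => ?_⟩
  have hφ' : Continuous fun y => fderiv ℝ φ y (EuclideanSpace.single j 1) :=
    (hφ.continuous_fderiv (by simp)).clm_apply continuous_const
  obtain ⟨l₁, hl₁⟩ := exists_pairing hΩ ((hφ'.memLp_of_hasCompactSupport
    (hc.fderiv_apply (𝕜 := ℝ) _) (μ := volume) (p := 2)).restrict Ω)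
  obtain ⟨l₂, hl₂⟩ := exists_pairing hΩ
    ((hφ.continuous.memLp_of_hasCompactSupport hc (μ := volume) (p := 2)).restrict Ω)
  have hk : ∀ k : Fin 2 → ℤ, l₁ (UnitAddTorus.mFourierLp 2 k) =
      -(Complex.I * k j * l₂ (UnitAddTorus.mFourierLp 2 k)) := fun k => by
    have hk' := ae_toTorus (UnitAddTorus.coeFn_mFourierLp 2 k) hΩ
    rw [hl₁, hl₂, ← integral_const_mul]
    have e₁ : ∫ y in Ω, UnitAddTorus.mFourierLp 2 k (toTorus y) *
        fderiv ℝ φ y (EuclideanSpace.single j 1) =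
        ∫ y in Ω, phase (WithLp.toLp 2 fun j => (k j : ℝ)) y *
          fderiv ℝ φ y (EuclideanSpace.single j 1) := by
      refine integral_congr_ae ?_
      filter_upwards [hk'] with y hy
      rw [hy, mFourier_toTorus]
    rw [e₁, setIntegral_mul_fderiv (contDiff_phase _) hφ hc hs]
    congr 1
    refine integral_congr_ae ?_
    filter_upwards [hk'] with y hy
    rw [hy, mFourier_toTorus, fderiv_phase]
    simp [mul_assoc]
  rw [← hl₁, ← hl₂]
  have s₁ := (UnitAddTorus.hasSum_mFourier_series_L2 p).mapL l₁
  have s₂ := ((UnitAddTorus.hasSum_mFourier_series_L2 g).mapL l₂).neg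
  have e : (fun k => l₁ (UnitAddTorus.mFourierCoeff p k • UnitAddTorus.mFourierLp 2 k)) =
      fun k => -l₂ (UnitAddTorus.mFourierCoeff g k • UnitAddTorus.mFourierLp 2 k) := by
    funext k
    rw [map_smul, map_smul, hk, h, smul_eq_mul, smul_eq_mul]
    ring
  rw [e] at s₁
  exact s₁.unique s₂

/-- Bounded Fourier multipliers act on `L²`. The form with two sources is the one met when a
first-order system is solved for one of its unknowns. -/
lemma exists_multiplier {m₀ m₁ : (Fin 2 → ℤ) → ℂ} {C : ℝ} (h₀ : ∀ k, ‖m₀ k‖ ≤ C)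
    (h₁ : ∀ k, ‖m₁ k‖ ≤ C) (q₀ q₁ : TorusL2) :
    ∃ p : TorusL2, (∀ k, UnitAddTorus.mFourierCoeff p k =
      m₀ k * UnitAddTorus.mFourierCoeff q₀ k + m₁ k * UnitAddTorus.mFourierCoeff q₁ k) ∧
      ‖p‖ ≤ C * (‖q₀‖ + ‖q₁‖) := by
  have key : ∀ (m : (Fin 2 → ℤ) → ℂ) (_ : ∀ k, ‖m k‖ ≤ C) (q : TorusL2), ∃ p : TorusL2,
      (∀ k, UnitAddTorus.mFourierCoeff p k = m k * UnitAddTorus.mFourierCoeff q k) ∧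
        ‖p‖ ≤ C * ‖q‖ := fun m hm q => by
    have hC : 0 ≤ C := (norm_nonneg _).trans (hm 0)
    let b := UnitAddTorus.mFourierBasis (d := Fin 2)
    have hle : ∀ k, ‖m k * b.repr q k‖ ≤ ‖((C : ℂ) • b.repr q) k‖ := fun k => by
      rw [lp.coeFn_smul, Pi.smul_apply, norm_mul, norm_smul, Complex.norm_real, Real.norm_of_nonneg hC]
      gcongr
      exact hm k
    have hmem : Memℓp (fun k => m k * b.repr q k) 2 :=
      (lp.memℓp ((C : ℂ) • b.repr q)).mono' hle
    refine ⟨b.repr.symm ⟨_, hmem⟩, fun k => ?_, ?_⟩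
    · rw [← UnitAddTorus.mFourierBasis_repr, ← UnitAddTorus.mFourierBasis_repr,
        LinearIsometryEquiv.apply_symm_apply]
    · rw [LinearIsometryEquiv.norm_map, ← b.repr.norm_map q]
      have := lp.norm_mono (p := 2) (by simp) (x := (⟨_, hmem⟩ : lp (fun _ : Fin 2 → ℤ => ℂ) 2)) hle
      rwa [norm_smul, Complex.norm_real, Real.norm_of_nonneg hC] at this
  obtain ⟨p₀, e₀, n₀⟩ := key m₀ h₀ q₀
  obtain ⟨p₁, e₁, n₁⟩ := key m₁ h₁ q₁
  refine ⟨p₀ + p₁, fun k => ?_, ?_⟩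
  · rw [← e₀, ← e₁]
    simp_rw [← UnitAddTorus.mFourierBasis_repr]
    simp
  · rw [mul_add]
    exact (norm_add_le _ _).trans (add_le_add n₀ n₁)

end Torus

/-! ### Calculus of weak derivatives -/

lemma interior_cell_ae_eq : interior cell =ᵐ[volume] cell := by
  refine interior_ae_eq_of_null_frontier (Convex.addHaar_frontier volume ?_)
  have : cell = ⋂ j, (EuclideanSpace.proj j : Plane →L[ℝ] ℝ) ⁻¹' Ico (-Real.pi) Real.pi := by
    ext; simp [cell]
  rw [this]
  exact convex_iInter fun j =>
    (convex_Ico _ _).linear_preimage (EuclideanSpace.proj j : Plane →L[ℝ] ℝ).toLinearMap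

lemma restrict_interior_cell :
    (volume : Measure Plane).restrict (interior cell) = volume.restrict cell :=
  Measure.restrict_congr_set interior_cell_ae_eq

instance isFiniteMeasure_restrict_cell : IsFiniteMeasure ((volume : Measure Plane).restrict cell) :=
  ⟨by rw [Measure.restrict_apply_univ]; exact isBounded_cell.measure_lt_top⟩

section WeakPartial

variable {Ω : Set Plane} {j : Fin 2} {u u' g g' φ : Plane → ℂ}

lemma integrable_mul_test (hu : MemLp u 2 (volume.restrict Ω)) (hφ : Continuous φ)
    (hc : HasCompactSupport φ) : Integrable (fun y => u y * φ y) (volume.restrict Ω) :=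
  hu.integrable_mul (q := 2) ((hφ.memLp_of_hasCompactSupport hc).restrict Ω)

lemma integrable_mul_fderiv_test (hu : MemLp u 2 (volume.restrict Ω)) (hφ : ContDiff ℝ ∞ φ)
    (hc : HasCompactSupport φ) (v : Plane) :
    Integrable (fun y => u y * fderiv ℝ φ y v) (volume.restrict Ω) :=
  integrable_mul_test hu ((hφ.continuous_fderiv (by simp)).clm_apply continuous_const)
    (hc.fderiv_apply (𝕜 := ℝ) v)

lemma IsL2WeakPartial.add (hu : MemLp u 2 (volume.restrict Ω)) (hu' : MemLp u' 2 (volume.restrict Ω))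
    (h : IsL2WeakPartial Ω j u g) (h' : IsL2WeakPartial Ω j u' g') :
    IsL2WeakPartial Ω j (fun y => u y + u' y) (fun y => g y + g' y) := by
  refine ⟨h.1.add h'.1, fun φ hφ hc hs => ?_⟩
  simp_rw [add_mul]
  rw [integral_add (integrable_mul_fderiv_test hu hφ hc _) (integrable_mul_fderiv_test hu' hφ hc _),
    integral_add (integrable_mul_test h.1 hφ.continuous hc)
      (integrable_mul_test h'.1 hφ.continuous hc), h.2 φ hφ hc hs, h'.2 φ hφ hc hs]
  ring

lemma IsL2WeakPartial.sub (hu : MemLp u 2 (volume.restrict Ω)) (hu' : MemLp u' 2 (volume.restrict Ω))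
    (h : IsL2WeakPartial Ω j u g) (h' : IsL2WeakPartial Ω j u' g') :
    IsL2WeakPartial Ω j (fun y => u y - u' y) (fun y => g y - g' y) := by
  refine ⟨h.1.sub h'.1, fun φ hφ hc hs => ?_⟩
  simp_rw [sub_mul]
  rw [integral_sub (integrable_mul_fderiv_test hu hφ hc _) (integrable_mul_fderiv_test hu' hφ hc _),
    integral_sub (integrable_mul_test h.1 hφ.continuous hc)
      (integrable_mul_test h'.1 hφ.continuous hc), h.2 φ hφ hc hs, h'.2 φ hφ hc hs]
  ring

lemma memLp_phase_mul (θ : Plane) {μ : Measure Plane} (hu : MemLp u 2 μ) :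
    MemLp (fun y => phase θ y * u y) 2 μ :=
  hu.of_le ((contDiff_phase (n := 0) θ).continuous.aestronglyMeasurable.mul hu.1)
    (.of_forall fun y => by rw [norm_mul, norm_phase, one_mul])

/-- The product rule `∂ⱼ(e^{iθ·y}u) = e^{iθ·y}(∂ⱼu + iθⱼu)`. -/
lemma IsL2WeakPartial.phase_mul (θ : Plane) (hu : MemLp u 2 (volume.restrict Ω))
    (h : IsL2WeakPartial Ω j u g) :
    IsL2WeakPartial Ω j (fun y => phase θ y * u y)
      (fun y => phase θ y * (g y + Complex.I * θ j * u y)) := by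
  have hu₁ : MemLp (fun y => Complex.I * θ j * u y) 2 (volume.restrict Ω) := hu.const_mul _
  refine ⟨memLp_phase_mul θ (h.1.add hu₁), fun φ hφ hc hs => ?_⟩
  have hψ : ContDiff ℝ ∞ fun y => phase θ y * φ y := (contDiff_phase θ).mul hφ
  have hcψ : HasCompactSupport fun y => phase θ y * φ y := hc.mul_left
  have hd : ∀ y, fderiv ℝ (fun y => phase θ y * φ y) y (EuclideanSpace.single j 1) =
      phase θ y * fderiv ℝ φ y (EuclideanSpace.single j 1) +
        Complex.I * θ j * (phase θ y * φ y) := fun y => by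
    rw [fderiv_fun_mul ((contDiff_phase (n := 1) θ).differentiable (by simp) y)
      (hφ.differentiable (by simp) y)]
    simp only [add_apply, smul_apply, smul_eq_mul,
      fderiv_phase]
    ring
  -- The product of a test function with a plane wave is again a test function.
  have key := h.2 _ hψ hcψ ((tsupport_mul_subset_right).trans hs)
  have e : ∫ y in Ω, u y * fderiv ℝ (fun y => phase θ y * φ y) y (EuclideanSpace.single j 1) =
      (∫ y in Ω, phase θ y * u y * fderiv ℝ φ y (EuclideanSpace.single j 1)) +
        ∫ y in Ω, Complex.I * θ j * u y * (phase θ y * φ y) := by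
    rw [← integral_add (integrable_mul_fderiv_test (memLp_phase_mul θ hu) hφ hc _)
      (integrable_mul_test hu₁ hψ.continuous hcψ)]
    refine integral_congr_ae (.of_forall fun y => ?_)
    simp only [hd]
    ring
  have e' : ∫ y in Ω, phase θ y * (g y + Complex.I * θ j * u y) * φ y =
      (∫ y in Ω, g y * (phase θ y * φ y)) + ∫ y in Ω, Complex.I * θ j * u y * (phase θ y * φ y) := by
    rw [← integral_add (integrable_mul_test h.1 hψ.continuous hcψ)
      (integrable_mul_test hu₁ hψ.continuous hcψ)]
    refine integral_congr_ae (.of_forall fun y => ?_)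
    ring
  rw [e', neg_add, ← key, e]
  ring

/-- Weak partial derivatives on an open set are unique. -/
lemma IsL2WeakPartial.ae_eq (hΩ : IsOpen Ω) (h : IsL2WeakPartial Ω j u g)
    (h' : IsL2WeakPartial Ω j u g') : g =ᵐ[volume.restrict Ω] g' := by
  have hloc : LocallyIntegrableOn (fun y => g y - g' y) Ω := fun x hx => by
    obtain ⟨r, hr, hrΩ⟩ := Metric.isOpen_iff.1 hΩ x hx
    refine ⟨_, inter_mem_nhdsWithin Ω (Metric.ball_mem_nhds x hr), ?_⟩
    rw [inter_eq_right.2 hrΩ]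
    have : IsFiniteMeasure ((volume : Measure Plane).restrict (Metric.ball x r)) :=
      ⟨by rw [Measure.restrict_apply_univ]; exact measure_ball_lt_top⟩
    exact ((h.1.sub h'.1).mono_measure (Measure.restrict_mono hrΩ le_rfl)).integrable (by norm_num)
  have := hΩ.ae_eq_zero_of_integral_contDiff_smul_eq_zero hloc fun φ hφ hc hs => by
    have hφ' : ContDiff ℝ ∞ fun y => (φ y : ℂ) := Complex.ofRealCLM.contDiff.comp hφ
    have hc' : HasCompactSupport fun y => (φ y : ℂ) := hc.comp_left Complex.ofReal_zero
    have hs' : tsupport (fun y => (φ y : ℂ)) ⊆ Ω :=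
      (closure_mono (Function.support_subset_iff'.2 fun y hy => by
        simp [Function.notMem_support.1 hy])).trans hs
    have e := (h.2 _ hφ' hc' hs').symm.trans (h'.2 _ hφ' hc' hs')
    rw [neg_inj, ← sub_eq_zero, ← integral_sub (integrable_mul_test h.1 hφ'.continuous hc')
      (integrable_mul_test h'.1 hφ'.continuous hc')] at e
    rw [← setIntegral_eq_integral_of_forall_compl_eq_zero (s := Ω)]
    · rw [← e]
      refine integral_congr_ae (.of_forall fun y => ?_)
      simp only [Complex.real_smul]
      ring
    · intro y hy
      rw [image_eq_zero_of_notMem_tsupport (fun h => hy (hs h)), zero_smul]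
  filter_upwards [ae_restrict_of_ae this, ae_restrict_mem hΩ.measurableSet] with y hy hyΩ
  exact sub_eq_zero.1 (hy hyΩ)

/-- The derivative chosen in `weakPartial` is any given weak derivative, almost everywhere. -/
lemma weakPartial_ae_eq (h : IsL2WeakPartial (interior cell) j u g) :
    weakPartial j u =ᵐ[volume.restrict cell] g := by
  have hex : ∃ g, IsL2WeakPartial (interior cell) j u g := ⟨g, h⟩
  rw [weakPartial, dif_pos hex, ← restrict_interior_cell]
  exact hex.choose_spec.ae_eq isOpen_interior h

end WeakPartial

/-! ### The `L²` and `H¹` norms of the cell -/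

section CellNorm

variable {f g : Plane → ℂ}

lemma cellNorm_nonneg (f : Plane → ℂ) : 0 ≤ cellNorm f := ENNReal.toReal_nonneg

lemma cellNorm_congr_ae (h : f =ᵐ[volume.restrict cell] g) : cellNorm f = cellNorm g := by
  rw [cellNorm, cellNorm, eLpNorm_congr_ae h]

lemma cellNorm_add_le (hf : MemLp f 2 (volume.restrict cell)) (hg : MemLp g 2 (volume.restrict cell)) :
    cellNorm (fun y => f y + g y) ≤ cellNorm f + cellNorm g := by
  rw [cellNorm, cellNorm, cellNorm, ← ENNReal.toReal_add hf.eLpNorm_ne_top hg.eLpNorm_ne_top]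
  exact ENNReal.toReal_mono (ENNReal.add_ne_top.2 ⟨hf.eLpNorm_ne_top, hg.eLpNorm_ne_top⟩)
    (eLpNorm_add_le hf.1 hg.1 (by norm_num))

lemma cellNorm_sub_le (hf : MemLp f 2 (volume.restrict cell)) (hg : MemLp g 2 (volume.restrict cell)) :
    cellNorm (fun y => f y - g y) ≤ cellNorm f + cellNorm g := by
  rw [cellNorm, cellNorm, cellNorm, ← ENNReal.toReal_add hf.eLpNorm_ne_top hg.eLpNorm_ne_top]
  exact ENNReal.toReal_mono (ENNReal.add_ne_top.2 ⟨hf.eLpNorm_ne_top, hg.eLpNorm_ne_top⟩)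
    (eLpNorm_sub_le hf.1 hg.1 (by norm_num))

lemma cellNorm_le_mul {c : ℝ} (hc : 0 ≤ c) (hg : MemLp g 2 (volume.restrict cell))
    (h : ∀ᵐ y ∂volume.restrict cell, ‖f y‖ ≤ c * ‖g y‖) : cellNorm f ≤ c * cellNorm g := by
  have := eLpNorm_le_mul_eLpNorm_of_ae_le_mul h 2
  refine (ENNReal.toReal_mono (ENNReal.mul_ne_top ENNReal.ofReal_ne_top hg.eLpNorm_ne_top)
    this).trans_eq ?_
  rw [ENNReal.toReal_mul, ENNReal.toReal_ofReal hc, cellNorm]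

lemma integral_cell_norm_sq (hf : MemLp f 2 (volume.restrict cell)) :
    ∫ y in cell, ‖f y‖ ^ 2 = cellNorm f ^ 2 := by
  have hi : 0 ≤ ∫ y in cell, ‖f y‖ ^ 2 := integral_nonneg fun y => by positivity
  rw [cellNorm, hf.eLpNorm_eq_integral_rpow_norm (by norm_num) (by norm_num)]
  simp only [ENNReal.toReal_ofNat, Real.rpow_ofNat]
  rw [ENNReal.toReal_ofReal (by positivity), ← Real.rpow_natCast, ← Real.rpow_mul hi]
  norm_num

/-- Integration over the cell is bounded on `L²(□)`, by Cauchy-Schwarz. -/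
lemma exists_norm_integral_cell_le : ∃ C : ℝ, 0 ≤ C ∧ ∀ f : Plane → ℂ,
    MemLp f 2 (volume.restrict cell) → ‖∫ y in cell, f y‖ ≤ C * cellNorm f := by
  refine ⟨_, cellNorm_nonneg fun _ => 1, fun f hf => ?_⟩
  have h1 : MemLp (fun _ : Plane => (1 : ℂ)) 2 (volume.restrict cell) := memLp_const 1
  have h2 := eLpNorm_smul_le_mul_eLpNorm (p := 2) (q := 2) (r := 1) hf.1 h1.1
  have h3 : ‖∫ y in cell, f y‖ ≤ (eLpNorm f 1 (volume.restrict cell)).toReal := by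
    refine (norm_integral_le_integral_norm _).trans_eq ?_
    rw [integral_norm_eq_lintegral_enorm hf.1, eLpNorm_one_eq_lintegral_enorm]
  refine h3.trans ?_
  rw [cellNorm, cellNorm, ← ENNReal.toReal_mul]
  refine ENNReal.toReal_mono (ENNReal.mul_ne_top h1.eLpNorm_ne_top hf.eLpNorm_ne_top) ?_
  convert h2 using 2
  ext; simp

end CellNorm

/-- Membership in `H¹(□; ℂ²)`, phrased with the chosen derivatives `weakPartial` that `h1Norm`
uses. The integrals in `h1Norm` then converge. -/
structure MemH1Cell (u : Plane → Fin 2 → ℂ) : Prop where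
  memLp : ∀ k, MemLp (fun y => u y k) 2 (volume.restrict cell)
  memLp_weakPartial : ∀ j k, MemLp (weakPartial j fun y => u y k) 2 (volume.restrict cell)

lemma MemH1Cell.h1Norm_eq {u : Plane → Fin 2 → ℂ} (hu : MemH1Cell u) :
    h1Norm u = Real.sqrt (∑ k, (cellNorm (fun y => u y k) ^ 2 +
      ∑ j, cellNorm (weakPartial j fun y => u y k) ^ 2)) := by
  simp_rw [h1Norm, integral_cell_norm_sq (hu.memLp _),
    integral_cell_norm_sq (hu.memLp_weakPartial _ _)]

lemma MemH1Cell.cellNorm_le {u : Plane → Fin 2 → ℂ} (hu : MemH1Cell u) (k : Fin 2) :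
    cellNorm (fun y => u y k) ≤ h1Norm u := by
  rw [hu.h1Norm_eq]
  refine Real.le_sqrt_of_sq_le ?_
  fin_cases k <;> simp [Fin.sum_univ_two] <;>
  nlinarith [sq_nonneg (cellNorm fun y => u y 0)]

lemma MemH1Cell.cellNorm_weakPartial_le {u : Plane → Fin 2 → ℂ} (hu : MemH1Cell u) (j k : Fin 2) :
    cellNorm (weakPartial j fun y => u y k) ≤ h1Norm u := by
  rw [hu.h1Norm_eq]
  refine Real.le_sqrt_of_sq_le ?_
  have h : ∀ k ∈ Finset.univ, 0 ≤ cellNorm (fun y => u y k) ^ 2 +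
      ∑ j, cellNorm (weakPartial j fun y => u y k) ^ 2 := fun k _ => by positivity
  refine le_trans ?_ (Finset.single_le_sum h (Finset.mem_univ k))
  refine le_add_of_nonneg_of_le (by positivity) ?_
  exact Finset.single_le_sum (f := fun j => cellNorm (weakPartial j fun y => u y k) ^ 2)
    (fun _ _ => sq_nonneg _) (Finset.mem_univ j)

/-- The `H¹` norm is assembled from six `L²` norms, and `√6 ≤ 3`. -/
lemma MemH1Cell.h1Norm_le {u : Plane → Fin 2 → ℂ} (hu : MemH1Cell u) {B : ℝ} (hB : 0 ≤ B)
    (h : ∀ k, cellNorm (fun y => u y k) ≤ B)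
    (h' : ∀ j k, cellNorm (weakPartial j fun y => u y k) ≤ B) : h1Norm u ≤ 3 * B := by
  rw [hu.h1Norm_eq]
  refine Real.sqrt_le_iff.2 ⟨by positivity, ?_⟩
  have e : ∀ k, cellNorm (fun y => u y k) ^ 2 ≤ B ^ 2 := fun k =>
    pow_le_pow_left₀ (cellNorm_nonneg _) (h k) 2
  have e' : ∀ j k, cellNorm (weakPartial j fun y => u y k) ^ 2 ≤ B ^ 2 := fun j k =>
    pow_le_pow_left₀ (cellNorm_nonneg _) (h' j k) 2
  simp only [Fin.sum_univ_two]
  nlinarith [e 0, e 1, e' 0 0, e' 0 1, e' 1 0, e' 1 1, sq_nonneg B]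

lemma h1Norm_nonneg (u : Plane → Fin 2 → ℂ) : 0 ≤ h1Norm u := Real.sqrt_nonneg _

/-! ### The twisted div-curl system -/

section DivCurl

/-- The circle is normalised to total mass one, as in Mathlib's multivariate Fourier series. -/
local instance : MeasureSpace UnitAddCircle := ⟨AddCircle.haarAddCircle⟩

local instance : Measure.IsAddHaarMeasure (volume : Measure UnitAddCircle) :=
  inferInstanceAs (Measure.IsAddHaarMeasure AddCircle.haarAddCircle)

local instance : IsProbabilityMeasure (volume : Measure UnitAddCircle) :=
  inferInstanceAs (IsProbabilityMeasure AddCircle.haarAddCircle)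

local notation "TorusL2" => Lp ℂ 2 (volume : Measure (UnitAddTorus (Fin 2)))

/-- Away from the zero mode the frequencies `k + θ` stay away from zero, uniformly over the dual
cell. -/
lemma quarter_le_sq_add_sq {θ : Plane} (hθ : θ ∈ dualCell) {k : Fin 2 → ℤ} (hk : k ≠ 0) :
    (1 / 4 : ℝ) ≤ (k 0 + θ 0) ^ 2 + (k 1 + θ 1) ^ 2 := by
  have key : ∀ j, k j ≠ 0 → (1 / 4 : ℝ) ≤ (k j + θ j) ^ 2 := fun j hj => by
    have h1 := (hθ j).1
    have h2 := (hθ j).2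
    rcases lt_or_gt_of_ne hj with h | h
    · have : (k j : ℝ) ≤ -1 := by exact_mod_cast (by omega : k j ≤ -1)
      nlinarith
    · have : (1 : ℝ) ≤ k j := by exact_mod_cast (by omega : 1 ≤ k j)
      nlinarith
  obtain ⟨j, hj⟩ := Function.ne_iff.1 hk
  have := key j hj
  fin_cases j
  · exact this.trans (le_add_of_nonneg_right (sq_nonneg _))
  · exact this.trans (le_add_of_nonneg_left (sq_nonneg _))

/-- The `i`-th component of `-iξ/|ξ|²`, where `ξ = k + θ`, and `0` for `k = 0`. These two
multipliers invert the symbol `(δ₀, δ₁) ↦ (iξ₀δ₀ + iξ₁δ₁, iξ₀δ₁ - iξ₁δ₀)` of the divergence and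
the curl. -/
def invSymbol (θ : Plane) (i : Fin 2) (k : Fin 2 → ℤ) : ℂ :=
  if k = 0 then 0 else
    -Complex.I * ((k i + θ i) / ((k 0 + θ 0) ^ 2 + (k 1 + θ 1) ^ 2) : ℝ)

lemma norm_invSymbol_le {θ : Plane} (hθ : θ ∈ dualCell) (i : Fin 2) (k : Fin 2 → ℤ) :
    ‖invSymbol θ i k‖ ≤ 2 := by
  by_cases hk : k = 0
  · simp [invSymbol, hk]
  have hs := quarter_le_sq_add_sq hθ hk
  have hi : (k i + θ i) ^ 2 ≤ (k 0 + θ 0) ^ 2 + (k 1 + θ 1) ^ 2 := by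
    fin_cases i <;> simp [sq_nonneg]
  rw [invSymbol, if_neg hk, norm_mul, norm_neg, Complex.norm_I, one_mul, Complex.norm_real]
  set s := (k 0 + θ 0) ^ 2 + (k 1 + θ 1) ^ 2
  rw [Real.norm_eq_abs, abs_div, abs_of_pos (a := s) (by linarith), div_le_iff₀ (by linarith),
    abs_le]
  constructor <;> nlinarith [sq_nonneg (k i + θ i - 1 / 2), sq_nonneg (k i + θ i + 1 / 2)]

/-- The multipliers gain one derivative: `|kⱼξᵢ| ≤ |ξⱼξᵢ| + |θⱼξᵢ|`, and each term is at most
`|ξ|²`. -/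
lemma norm_mul_invSymbol_le {θ : Plane} (hθ : θ ∈ dualCell) (i j : Fin 2) (k : Fin 2 → ℤ) :
    ‖Complex.I * k j * invSymbol θ i k‖ ≤ 2 := by
  by_cases hk : k = 0
  · simp [invSymbol, hk]
  have hs := quarter_le_sq_add_sq hθ hk
  have hi : ∀ i, (k i + θ i) ^ 2 ≤ (k 0 + θ 0) ^ 2 + (k 1 + θ 1) ^ 2 := fun i => by
    fin_cases i <;> simp [sq_nonneg]
  have e : Complex.I * k j * invSymbol θ i k =
      ((k j * (k i + θ i) / ((k 0 + θ 0) ^ 2 + (k 1 + θ 1) ^ 2) : ℝ) : ℂ) := by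
    rw [invSymbol, if_neg hk]
    push_cast
    linear_combination (-(k j * ((k i + θ i) / ((k 0 + θ 0) ^ 2 + (k 1 + θ 1) ^ 2)) : ℂ)) *
      Complex.I_sq
  rw [e, Complex.norm_real]
  set s := (k 0 + θ 0) ^ 2 + (k 1 + θ 1) ^ 2
  rw [Real.norm_eq_abs, abs_div, abs_of_pos (a := s) (by linarith), div_le_iff₀ (by linarith)]
  have h1 : |(k j + θ j) * (k i + θ i)| ≤ s := by
    rw [abs_le]
    constructor <;> nlinarith [hi i, hi j, sq_nonneg (k j + θ j - (k i + θ i)),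
      sq_nonneg (k j + θ j + (k i + θ i))]
  have h2 : |θ j * (k i + θ i)| ≤ s := by
    have ht : θ j ^ 2 ≤ 1 / 4 := by
      have h1 := (hθ j).1
      have h2 := (hθ j).2
      nlinarith
    rw [abs_le]
    constructor <;> nlinarith [hi i, sq_nonneg (θ j - (k i + θ i)),
      sq_nonneg (θ j + (k i + θ i))]
  calc |k j * (k i + θ i)| = |(k j + θ j) * (k i + θ i) - θ j * (k i + θ i)| := by ring_nf
    _ ≤ |(k j + θ j) * (k i + θ i)| + |θ j * (k i + θ i)| := abs_sub _ _
    _ ≤ 2 * s := by linarith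

lemma invSymbol_div {θ : Plane} (hθ : θ ∈ dualCell) {k : Fin 2 → ℤ} (hk : k ≠ 0) :
    Complex.I * (k 0 + θ 0) * invSymbol θ 0 k + Complex.I * (k 1 + θ 1) * invSymbol θ 1 k = 1 := by
  have hs := quarter_le_sq_add_sq hθ hk
  have hs' : (((k 0 : ℂ) + θ 0) ^ 2 + (k 1 + θ 1) ^ 2) ≠ 0 := by
    have : (k 0 + θ 0) ^ 2 + (k 1 + θ 1) ^ 2 ≠ 0 := by linarith
    simpa using Complex.ofReal_ne_zero.2 this
  simp only [invSymbol, if_neg hk]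
  push_cast
  field_simp
  linear_combination (-(((k 0 : ℂ) + θ 0) ^ 2 + (k 1 + θ 1) ^ 2)) * Complex.I_sq

lemma invSymbol_curl (θ : Plane) (k : Fin 2 → ℤ) :
    (k 0 + θ 0) * invSymbol θ 1 k = (k 1 + θ 1) * invSymbol θ 0 k := by
  by_cases hk : k = 0
  · simp [invSymbol, hk]
  simp only [invSymbol, if_neg hk]
  push_cast
  ring

lemma toTorus_add_period (j : Fin 2) (y : Plane) :
    toTorus (y + EuclideanSpace.single j (2 * Real.pi)) = toTorus y := by
  ext i
  by_cases h : i = j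
  · subst h
    simp [toTorus, add_div]
  · simp [toTorus, h]

/-- A linear relation between Fourier coefficients holds between the functions. -/
lemma linearCombination_toTorus {p₁ p₂ p₃ p₄ q : TorusL2} {c₁ c₂ c₃ c₄ : ℂ}
    (h : ∀ k, c₁ * UnitAddTorus.mFourierCoeff p₁ k + c₂ * UnitAddTorus.mFourierCoeff p₂ k +
      c₃ * UnitAddTorus.mFourierCoeff p₃ k + c₄ * UnitAddTorus.mFourierCoeff p₄ k =
      UnitAddTorus.mFourierCoeff q k) :
    ∀ᵐ y ∂volume.restrict cell, c₁ * p₁ (toTorus y) + c₂ * p₂ (toTorus y) +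
      c₃ * p₃ (toTorus y) + c₄ * p₄ (toTorus y) = q (toTorus y) := by
  have e : c₁ • p₁ + c₂ • p₂ + c₃ • p₃ + c₄ • p₄ = q := by
    apply (UnitAddTorus.mFourierBasis (d := Fin 2)).repr.injective
    ext k
    simp_rw [← UnitAddTorus.mFourierBasis_repr] at h
    rw [← h k]
    simp only [map_add, map_smul, lp.coeFn_add, lp.coeFn_smul, Pi.add_apply, Pi.smul_apply,
      smul_eq_mul]
  refine ae_toTorus (P := fun x => c₁ * p₁ x + c₂ * p₂ x + c₃ * p₃ x + c₄ * p₄ x = q x) ?_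
    isBounded_cell
  rw [← e]
  filter_upwards [Lp.coeFn_add (c₁ • p₁ + c₂ • p₂ + c₃ • p₃) (c₄ • p₄),
    Lp.coeFn_add (c₁ • p₁ + c₂ • p₂) (c₃ • p₃), Lp.coeFn_add (c₁ • p₁) (c₂ • p₂),
    Lp.coeFn_smul c₁ p₁, Lp.coeFn_smul c₂ p₂, Lp.coeFn_smul c₃ p₃, Lp.coeFn_smul c₄ p₄]
    with x h1 h2 h3 h4 h5 h6 h7
  rw [h1, Pi.add_apply, h2, Pi.add_apply, h3, Pi.add_apply, h4, h5, h6, h7]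
  simp

/-- The periodic div-curl system twisted by a quasi-momentum, `(∇ + iθ)·δ = f₀` and
`(∇ + iθ)×δ = f₁`, is solvable for sources of mean zero, with an `H¹` bound that does not depend
on `θ` in the dual cell. -/
theorem exists_periodic_divCurl {θ : Plane} (hθ : θ ∈ dualCell) {f₀ f₁ : Plane → ℂ}
    (hf₀ : MemLp f₀ 2 (volume.restrict cell)) (hf₁ : MemLp f₁ 2 (volume.restrict cell))
    (hm₀ : ∫ y in cell, f₀ y = 0) (hm₁ : ∫ y in cell, f₁ y = 0) :
    ∃ (δ : Plane → Fin 2 → ℂ) (g : Fin 2 → Fin 2 → Plane → ℂ), δ ∈ H1Per ∧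
      (∀ j k, IsL2WeakPartial (interior cell) j (fun y => δ y k) (g j k)) ∧
      (∀ᵐ y ∂volume.restrict cell, g 0 0 y + g 1 1 y +
        Complex.I * θ 0 * δ y 0 + Complex.I * θ 1 * δ y 1 = f₀ y) ∧
      (∀ᵐ y ∂volume.restrict cell, g 0 1 y - g 1 0 y +
        Complex.I * θ 0 * δ y 1 - Complex.I * θ 1 * δ y 0 = f₁ y) ∧
      (∀ k, cellNorm (fun y => δ y k) ≤ 2 * (cellNorm f₀ + cellNorm f₁)) ∧
      ∀ j k, cellNorm (g j k) ≤ 2 * (cellNorm f₀ + cellNorm f₁) := by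
  obtain ⟨q₀, hq₀⟩ := exists_torusL2 hf₀
  obtain ⟨q₁, hq₁⟩ := exists_torusL2 hf₁
  have hz : ∀ {q : TorusL2} {f : Plane → ℂ}, (fun y => q (toTorus y)) =ᵐ[volume.restrict cell] f →
      ∫ y in cell, f y = 0 → UnitAddTorus.mFourierCoeff q 0 = 0 := fun {q f} h h0 => by
    have := mFourierCoeff_zero_of_integral_cell q
    rw [integral_congr_ae h, h0, mul_eq_zero] at this
    exact this.resolve_left (by simp [Real.pi_ne_zero])
  have hz₀ := hz hq₀ hm₀
  have hz₁ := hz hq₁ hm₁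
  let A := invSymbol θ
  have hA := norm_invSymbol_le hθ
  have hA' := norm_mul_invSymbol_le hθ
  have hAn : ∀ k, ‖-A 1 k‖ ≤ 2 := fun k => by rw [norm_neg]; exact hA 1 k
  have hAn' : ∀ j k, ‖-(Complex.I * k j * A 1 k)‖ ≤ 2 := fun j k => by rw [norm_neg]; exact hA' 1 j k
  obtain ⟨d₀, cd₀, nd₀⟩ := exists_multiplier (hA 0) hAn q₀ q₁
  obtain ⟨d₁, cd₁, nd₁⟩ := exists_multiplier (hA 1) (hA 0) q₀ q₁
  choose g₀ cg₀ ng₀ using fun j => exists_multiplier (hA' 0 j) (hAn' j) q₀ q₁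
  choose g₁ cg₁ ng₁ using fun j => exists_multiplier (hA' 1 j) (hA' 0 j) q₀ q₁
  have hw₀ : ∀ (j) {Ω : Set Plane}, Bornology.IsBounded Ω →
      IsL2WeakPartial Ω j (fun y => d₀ (toTorus y)) (fun y => g₀ j (toTorus y)) := fun j Ω hΩ =>
    isL2WeakPartial_toTorus (fun k => by rw [cd₀, cg₀]; ring) hΩ
  have hw₁ : ∀ (j) {Ω : Set Plane}, Bornology.IsBounded Ω →
      IsL2WeakPartial Ω j (fun y => d₁ (toTorus y)) (fun y => g₁ j (toTorus y)) := fun j Ω hΩ =>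
    isL2WeakPartial_toTorus (fun k => by rw [cd₁, cg₁]; ring) hΩ
  have hn : ∀ p : TorusL2, ‖p‖ ≤ 2 * (‖q₀‖ + ‖q₁‖) →
      cellNorm (fun y => p (toTorus y)) ≤ 2 * (cellNorm f₀ + cellNorm f₁) := fun p hp => by
    rw [← cellNorm_congr_ae hq₀, ← cellNorm_congr_ae hq₁, cellNorm_toTorus, cellNorm_toTorus,
      cellNorm_toTorus]
    have := mul_le_mul_of_nonneg_left hp (by positivity : 0 ≤ 2 * Real.pi)
    linarith
  have hint : Bornology.IsBounded (interior cell) := isBounded_cell.subset interior_subset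
  refine ⟨fun y => ![d₀ (toTorus y), d₁ (toTorus y)],
    fun j => ![fun y => g₀ j (toTorus y), fun y => g₁ j (toTorus y)],
    ⟨fun j y => by simp only [toTorus_add_period], fun k Ω _ hΩ => ?_⟩, fun j k => ?_, ?_, ?_,
    fun k => ?_, fun j k => ?_⟩
  · obtain ⟨M, -, hM⟩ := exists_eLpNorm_comp_toTorus_le hΩ
    fin_cases k
    · exact ⟨(hM d₀ (Lp.memLp d₀)).1, fun j => ⟨_, hw₀ j hΩ⟩⟩
    · exact ⟨(hM d₁ (Lp.memLp d₁)).1, fun j => ⟨_, hw₁ j hΩ⟩⟩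
  · fin_cases k
    · exact hw₀ j hint
    · exact hw₁ j hint
  · have := linearCombination_toTorus (p₁ := g₀ 0) (p₂ := g₁ 1) (p₃ := d₀) (p₄ := d₁) (q := q₀)
      (c₁ := 1) (c₂ := 1) (c₃ := Complex.I * θ 0) (c₄ := Complex.I * θ 1) fun k => by
        rw [cg₀, cg₁, cd₀, cd₁]
        by_cases hk : k = 0
        · simp [hk, hz₀, hz₁]
        · linear_combination (UnitAddTorus.mFourierCoeff q₀ k) * invSymbol_div hθ hk -
            Complex.I * (UnitAddTorus.mFourierCoeff q₁ k) * invSymbol_curl θ k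
    filter_upwards [this, hq₀] with y hy hy'
    rw [← hy', ← hy]
    simp
  · have := linearCombination_toTorus (p₁ := g₁ 0) (p₂ := g₀ 1) (p₃ := d₁) (p₄ := d₀) (q := q₁)
      (c₁ := 1) (c₂ := -1) (c₃ := Complex.I * θ 0) (c₄ := -(Complex.I * θ 1)) fun k => by
        rw [cg₀, cg₁, cd₀, cd₁]
        by_cases hk : k = 0
        · simp [hk, hz₀, hz₁]
        · linear_combination (UnitAddTorus.mFourierCoeff q₁ k) * invSymbol_div hθ hk +
            Complex.I * (UnitAddTorus.mFourierCoeff q₀ k) * invSymbol_curl θ k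
    filter_upwards [this, hq₁] with y hy hy'
    rw [← hy', ← hy]
    simp
    ring
  · fin_cases k
    · exact hn _ nd₀
    · exact hn _ nd₁
  · fin_cases k
    · exact hn _ (ng₀ j)
    · exact hn _ (ng₁ j)

end DivCurl

/-! ### Comparison of quasi-periodic fields -/

lemma phase_add (θ η y : Plane) : phase (θ + η) y = phase θ y * phase η y := by
  rw [phase, phase, phase, ← Complex.exp_add, inner_add_left]
  push_cast
  ring_nf

lemma norm_phase_sub_phase_le (θ θ' : Plane) {y : Plane} (hy : y ∈ cell) :
    ‖phase θ y - phase θ' y‖ ≤ 2 * Real.pi * ‖θ - θ'‖ := by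
  have e : phase θ y - phase θ' y = phase θ' y * (phase (θ - θ') y - 1) := by
    rw [mul_sub, ← phase_add, add_sub_cancel, mul_one]
  rw [e, norm_mul, norm_phase, one_mul]
  calc ‖phase (θ - θ') y - 1‖ ≤ ‖(inner ℝ (θ - θ') y : ℝ)‖ :=
        Real.norm_exp_I_mul_ofReal_sub_one_le
    _ ≤ ‖θ - θ'‖ * ‖y‖ := norm_inner_le_norm _ _
    _ ≤ ‖θ - θ'‖ * (2 * Real.pi) := by gcongr; exact norm_le_of_mem_cell hy
    _ = _ := mul_comm _ _

lemma cellNorm_phase_mul (θ : Plane) (f : Plane → ℂ) :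
    cellNorm (fun y => phase θ y * f y) = cellNorm f := by
  rw [cellNorm, cellNorm]
  congr 1
  refine eLpNorm_congr_norm_ae (.of_forall fun y => ?_)
  rw [norm_mul, norm_phase, one_mul]

lemma memLp_phase_sub_mul (θ θ' : Plane) {f : Plane → ℂ} {μ : Measure Plane} (hf : MemLp f 2 μ) :
    MemLp (fun y => (phase θ y - phase θ' y) * f y) 2 μ := by
  simp_rw [sub_mul]
  exact (memLp_phase_mul θ hf).sub (memLp_phase_mul θ' hf)

lemma cellNorm_phase_sub_mul_le (θ θ' : Plane) {f : Plane → ℂ}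
    (hf : MemLp f 2 (volume.restrict cell)) :
    cellNorm (fun y => (phase θ y - phase θ' y) * f y) ≤
      2 * Real.pi * ‖θ - θ'‖ * cellNorm f := by
  refine cellNorm_le_mul (by positivity) hf ?_
  filter_upwards [ae_restrict_mem measurableSet_cell] with y hy
  rw [norm_mul]
  gcongr
  exact norm_phase_sub_phase_le θ θ' hy

/-- Adding a multiple of the indicator of `R` makes any source mean zero, at a cost controlled by
its `L²` norm. This is where `R` must have positive measure. -/
lemma exists_meanZero_correction {R : Set Plane} (hR : IsOpen R) (hne : R.Nonempty)
    (hcell : R ⊆ cell) :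
    ∃ K : ℝ, 0 ≤ K ∧ ∀ f : Plane → ℂ, MemLp f 2 (volume.restrict cell) → ∃ c : ℂ,
      MemLp (fun y => f y + R.indicator (fun _ => c) y) 2 (volume.restrict cell) ∧
      (∫ y in cell, (f y + R.indicator (fun _ => c) y)) = 0 ∧
      cellNorm (fun y => f y + R.indicator (fun _ => c) y) ≤ K * cellNorm f := by
  obtain ⟨C, hC, hCf⟩ := exists_norm_integral_cell_le
  have hfin : volume R < ⊤ := (isBounded_cell.subset hcell).measure_lt_top
  have hvol : 0 < volume.real R := ENNReal.toReal_pos (hR.measure_pos volume hne).ne' hfin.ne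
  have hind : ∀ c : ℂ, MemLp (R.indicator fun _ => c) 2 (volume.restrict cell) := fun c =>
    (memLp_const c).indicator hR.measurableSet
  refine ⟨1 + C / volume.real R * cellNorm (R.indicator fun _ => 1), ?_, fun f hf => ?_⟩
  · have := cellNorm_nonneg (R.indicator fun _ => 1)
    positivity
  let c : ℂ := -(∫ y in cell, f y) / volume.real R
  have hc : ‖c‖ ≤ C / volume.real R * cellNorm f := by
    rw [norm_div, norm_neg, Complex.norm_real, Real.norm_of_nonneg hvol.le, div_mul_eq_mul_div]
    gcongr
    exact hCf f hf
  refine ⟨c, hf.add (hind c), ?_, ?_⟩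
  · rw [integral_add (hf.integrable (by norm_num)) ((hind c).integrable (by norm_num)),
      setIntegral_indicator hR.measurableSet, inter_eq_right.2 hcell, setIntegral_const,
      Complex.real_smul, mul_div_cancel₀ _ (by exact_mod_cast hvol.ne'), add_neg_cancel]
  · refine (cellNorm_add_le hf (hind c)).trans ?_
    have h1 : cellNorm (R.indicator fun _ => c) ≤ ‖c‖ * cellNorm (R.indicator fun _ => 1) :=
      cellNorm_le_mul (norm_nonneg c) (hind 1) (.of_forall fun y => by
        by_cases hy : y ∈ R <;> simp [hy])
    have h2 := mul_le_mul_of_nonneg_right hc (cellNorm_nonneg (R.indicator fun _ => 1))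
    linarith

lemma memH1Cell_of_weakPartial {u : Plane → Fin 2 → ℂ} {W : Fin 2 → Fin 2 → Plane → ℂ}
    (hu : ∀ k, MemLp (fun y => u y k) 2 (volume.restrict cell))
    (hW : ∀ j k, IsL2WeakPartial (interior cell) j (fun y => u y k) (W j k)) : MemH1Cell u :=
  ⟨hu, fun j k => (memLp_congr_ae (weakPartial_ae_eq (hW j k))).2
    (restrict_interior_cell ▸ (hW j k).1)⟩

lemma add_mem_H1Per {w δ : Plane → Fin 2 → ℂ} (hw : w ∈ H1Per) (hδ : δ ∈ H1Per) :
    (fun y k => w y k + δ y k) ∈ H1Per := by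
  refine ⟨fun j y => ?_, fun k Ω hΩ hb => ?_⟩
  · funext k
    change w _ k + δ _ k = w y k + δ y k
    rw [hw.1, hδ.1]
  · have h1 := hw.2 k Ω hΩ hb
    have h2 := hδ.2 k Ω hΩ hb
    refine ⟨h1.1.add h2.1, fun j => ?_⟩
    obtain ⟨g, hg⟩ := h1.2 j
    obtain ⟨g', hg'⟩ := h2.2 j
    exact ⟨_, hg.add h1.1 h2.1 hg'⟩

end

theorem mainTheorem4 (R : Set Plane) (hR : IsOpen R) (hne : R.Nonempty) (hcell : closure R ⊆ cell) :
    ∃ L : ℝ, 0 < L ∧ ∀ θ ∈ dualCell, ∀ θ' ∈ dualCell, ∀ v ∈ VSpace R θ,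
      (⨅ v' : VSpace R θ', h1Norm (v - v')) ≤ L * ‖θ - θ'‖ * h1Norm v := by
  obtain ⟨K, hK, hcorr⟩ := exists_meanZero_correction hR hne (subset_closure.trans hcell)
  -- Each of the six `L²` norms in `h1Norm (v - v')` is at most `(2π + 12 K + 1) |θ - θ'| ‖v‖`: the
  -- phase costs `2π`, the change of `iθ` costs `1`, and `δ` and its derivatives, each of norm at most
  -- `8 K |θ - θ'| ‖v‖`, contribute `8 K + 8 K / 2` because `|θ'ⱼ| ≤ 1/2`.
  refine ⟨3 * (2 * Real.pi + 12 * K + 1), by positivity, fun θ hθ θ' hθ' v hv => ?_⟩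
  obtain ⟨⟨w, hw, hvw⟩, hdiv, hcurl⟩ := hv
  set t := ‖θ - θ'‖
  set B := h1Norm v
  have hB : 0 ≤ B := h1Norm_nonneg v
  have hη : ∀ j, |θ j - θ' j| ≤ t := fun j => PiLp.norm_apply_le (θ - θ') j
  have hbdd : Bornology.IsBounded (interior cell) := isBounded_cell.subset interior_subset
  have hwH : ∀ k, MemH1 (interior cell) fun y => w y k := fun k => hw.2 k _ isOpen_interior hbdd
  choose hwL D hD using hwH
  have hvk : ∀ k, (fun y => v y k) = fun y => phase θ y * w y k := fun k => funext fun y => hvw y k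
  -- Weak derivatives of `v` in terms of those of `w`.
  have hV : ∀ j k, IsL2WeakPartial (interior cell) j (fun y => v y k)
      (fun y => phase θ y * (D k j y + Complex.I * θ j * w y k)) := fun j k => by
    rw [hvk]
    exact (hD k j).phase_mul θ (hwL k)
  have hV' := fun j k => weakPartial_ae_eq (hV j k)
  rw [restrict_interior_cell] at hwL
  have hvL : ∀ k, MemLp (fun y => v y k) 2 (volume.restrict cell) := fun k => by
    rw [hvk]
    exact memLp_phase_mul θ (hwL k)
  have hvH := memH1Cell_of_weakPartial hvL hV
  have hwB : ∀ k, cellNorm (fun y => w y k) ≤ B := fun k => by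
    rw [← cellNorm_phase_mul θ, ← hvk]
    exact hvH.cellNorm_le k
  have hsmall : ∀ j k, MemLp (fun y => Complex.I * (θ j - θ' j) * w y k) 2 (volume.restrict cell) ∧
      cellNorm (fun y => Complex.I * (θ j - θ' j) * w y k) ≤ t * B := fun j k => by
    refine ⟨(hwL k).const_mul _, ?_⟩
    refine (cellNorm_le_mul (c := t) (norm_nonneg _) (hwL k) (.of_forall fun y => ?_)).trans
      (mul_le_mul_of_nonneg_left (hwB k) (norm_nonneg _))
    rw [norm_mul, norm_mul, Complex.norm_I, one_mul, ← Complex.ofReal_sub, Complex.norm_real,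
      Real.norm_eq_abs]
    exact mul_le_mul_of_nonneg_right (hη j) (norm_nonneg _)
  -- The sources that turn `(∇ + iθ)` into `(∇ + iθ')` on `w`; the constants `c₀`, `c₁` only act inside
  -- `R`.
  let f₀ : Plane → ℂ := fun y =>
    Complex.I * (θ 0 - θ' 0) * w y 0 + Complex.I * (θ 1 - θ' 1) * w y 1
  let f₁ : Plane → ℂ := fun y =>
    Complex.I * (θ 0 - θ' 0) * w y 1 - Complex.I * (θ 1 - θ' 1) * w y 0
  have hf₀ : cellNorm f₀ ≤ t * B + t * B :=
    (cellNorm_add_le (hsmall 0 0).1 (hsmall 1 1).1).trans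
      (add_le_add (hsmall 0 0).2 (hsmall 1 1).2)
  have hf₁ : cellNorm f₁ ≤ t * B + t * B :=
    (cellNorm_sub_le (hsmall 0 1).1 (hsmall 1 0).1).trans
      (add_le_add (hsmall 0 1).2 (hsmall 1 0).2)
  obtain ⟨c₀, hq₀, hm₀, hn₀⟩ := hcorr f₀ ((hsmall 0 0).1.add (hsmall 1 1).1)
  obtain ⟨c₁, hq₁, hm₁, hn₁⟩ := hcorr f₁ ((hsmall 0 1).1.sub (hsmall 1 0).1)
  obtain ⟨δ, g, hδ, hg, he₀, he₁, hnδ, hng⟩ := exists_periodic_divCurl hθ' hq₀ hq₁ hm₀ hm₁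
  have hb : 2 * (cellNorm (fun y => f₀ y + R.indicator (fun _ => c₀) y) +
      cellNorm fun y => f₁ y + R.indicator (fun _ => c₁) y) ≤ 8 * K * (t * B) := by
    have h₀ := hn₀.trans (mul_le_mul_of_nonneg_left hf₀ hK)
    have h₁ := hn₁.trans (mul_le_mul_of_nonneg_left hf₁ hK)
    linarith only [h₀, h₁]
  replace hnδ := fun k => (hnδ k).trans hb
  replace hng := fun j k => (hng j k).trans hb
  have hδL : ∀ k, MemLp (fun y => δ y k) 2 (volume.restrict (interior cell)) := fun k =>
    (hδ.2 k _ isOpen_interior hbdd).1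
  -- The competitor `e^{iθ'·y}(w + δ)`.
  let v' : Plane → Fin 2 → ℂ := fun y k => phase θ' y * (w y k + δ y k)
  have hW : ∀ j k, IsL2WeakPartial (interior cell) j (fun y => v' y k)
      (fun y => phase θ' y * ((D k j y + g j k y) + Complex.I * θ' j * (w y k + δ y k))) :=
    fun j k => by
      have hwL' : MemLp (fun y => w y k) 2 (volume.restrict (interior cell)) := by
        rw [restrict_interior_cell]; exact hwL k
      exact ((hD k j).add hwL' (hδL k) (hg j k)).phase_mul θ' (hwL'.add (hδL k))
  have hW' := fun j k => weakPartial_ae_eq (hW j k)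
  rw [restrict_interior_cell] at hδL
  have hle : volume.restrict (cell \ R) ≤ (volume : Measure Plane).restrict cell :=
    Measure.restrict_mono sdiff_subset le_rfl
  have hRm : ∀ᵐ y ∂(volume : Measure Plane).restrict (cell \ R), y ∉ R := by
    filter_upwards [ae_restrict_mem (measurableSet_cell.diff hR.measurableSet)] with y hy using hy.2
  have hv' : v' ∈ VSpace R θ' := by
    refine ⟨⟨_, add_mem_H1Per hw hδ, fun y k => rfl⟩, ?_, ?_⟩
    · filter_upwards [hdiv, hRm, ae_mono hle he₀, ae_mono hle (hW' 0 0), ae_mono hle (hW' 1 1),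
        ae_mono hle (hV' 0 0), ae_mono hle (hV' 1 1)] with y h1 h2 h3 h4 h5 h6 h7
      rw [weakDiv, h6, h7, ← mul_add, mul_eq_zero] at h1
      replace h1 := h1.resolve_left (norm_ne_zero_iff.1 (by rw [norm_phase]; exact one_ne_zero))
      simp only [indicator_of_notMem h2, f₀] at h3
      rw [weakDiv, h4, h5]
      linear_combination phase θ' y * (h1 + h3)
    · filter_upwards [hcurl, hRm, ae_mono hle he₁, ae_mono hle (hW' 0 1), ae_mono hle (hW' 1 0),
        ae_mono hle (hV' 0 1), ae_mono hle (hV' 1 0)] with y h1 h2 h3 h4 h5 h6 h7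
      rw [weakCurl, h6, h7, ← mul_sub, mul_eq_zero] at h1
      replace h1 := h1.resolve_left (norm_ne_zero_iff.1 (by rw [norm_phase]; exact one_ne_zero))
      simp only [indicator_of_notMem h2, f₁] at h3
      rw [weakCurl, h4, h5]
      linear_combination phase θ' y * (h1 + h3)
  -- Its distance to `v` splits into the change of phase, the change of `iθ` and the contribution of
  -- `δ`.
  have hdiff : ∀ {f u : Plane → ℂ}, MemLp f 2 (volume.restrict cell) →
      u =ᵐ[volume.restrict cell] (fun y => phase θ y * f y) → cellNorm u ≤ B →
      cellNorm (fun y => (phase θ y - phase θ' y) * f y) ≤ 2 * Real.pi * t * B :=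
    fun {f u} hf hu huB => by
      rw [cellNorm_congr_ae hu, cellNorm_phase_mul] at huB
      exact (cellNorm_phase_sub_mul_le θ θ' hf).trans
        (mul_le_mul_of_nonneg_left huB (by positivity))
  have hv'L : ∀ k, MemLp (fun y => v' y k) 2 (volume.restrict cell) := fun k =>
    memLp_phase_mul θ' ((hwL k).add (hδL k))
  have hZ : ∀ j k, IsL2WeakPartial (interior cell) j (fun y => (v - v') y k) _ := fun j k =>
    (hV j k).sub (restrict_interior_cell ▸ hvL k) (restrict_interior_cell ▸ hv'L k) (hW j k)
  have hdH := memH1Cell_of_weakPartial (u := v - v') (fun k => (hvL k).sub (hv'L k)) hZ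
  have htB : 0 ≤ t * B := mul_nonneg (norm_nonneg _) hB
  have hfinal : h1Norm (v - v') ≤ 3 * ((2 * Real.pi + 12 * K + 1) * (t * B)) := by
    refine hdH.h1Norm_le (by positivity) (fun k => ?_) fun j k => ?_
    · have a := hdiff (hwL k) (hvk k).eventuallyEq (hvH.cellNorm_le k)
      have e : (fun y => (v - v') y k) =
          fun y => (phase θ y - phase θ' y) * w y k - phase θ' y * δ y k := funext fun y => by
        rw [Pi.sub_apply, Pi.sub_apply, hvw, ← phase]
        ring
      rw [e]
      refine (cellNorm_sub_le (memLp_phase_sub_mul θ θ' (hwL k)) (memLp_phase_mul θ' (hδL k))).trans ?_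
      rw [cellNorm_phase_mul]
      linarith [hnδ k, mul_nonneg hK htB]
    · have hf : MemLp (fun y => D k j y + Complex.I * θ j * w y k) 2 (volume.restrict cell) :=
        (restrict_interior_cell ▸ (hD k j).1).add ((hwL k).const_mul _)
      have a := hdiff hf (hV' j k) (hvH.cellNorm_weakPartial_le j k)
      have hgL : MemLp (g j k) 2 (volume.restrict cell) := restrict_interior_cell ▸ (hg j k).1
      have hδB : cellNorm (fun y => Complex.I * θ' j * δ y k) ≤ 1 / 2 * (8 * K * (t * B)) := by
        refine (cellNorm_le_mul (by norm_num : (0 : ℝ) ≤ 1 / 2) (hδL k) (.of_forall fun y => ?_)).trans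
          (mul_le_mul_of_nonneg_left (hnδ k) (by norm_num))
        rw [norm_mul, norm_mul, Complex.norm_I, one_mul, Complex.norm_real, Real.norm_eq_abs]
        gcongr
        exact abs_le.2 ⟨(hθ' j).1, (hθ' j).2.le⟩
      have hδL' : MemLp (fun y => Complex.I * θ' j * δ y k) 2 (volume.restrict cell) :=
        (hδL k).const_mul _
      have e : weakPartial j (fun y => (v - v') y k) =ᵐ[volume.restrict cell] fun y =>
          (((phase θ y - phase θ' y) * (D k j y + Complex.I * θ j * w y k) +
            phase θ' y * (Complex.I * (θ j - θ' j) * w y k)) - phase θ' y * g j k y) -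
            phase θ' y * (Complex.I * θ' j * δ y k) := by
        filter_upwards [weakPartial_ae_eq (hZ j k)] with y hy
        rw [hy]
        ring
      rw [cellNorm_congr_ae e]
      have a₁ := memLp_phase_sub_mul θ θ' hf
      have d₁ := memLp_phase_mul θ' (hsmall j k).1
      have b₁ := memLp_phase_mul θ' hgL
      have i₁ := cellNorm_sub_le ((a₁.add d₁).sub b₁) (memLp_phase_mul θ' hδL')
      have i₂ := cellNorm_sub_le (a₁.add d₁) b₁
      have i₃ := cellNorm_add_le a₁ d₁
      simp only [cellNorm_phase_mul] at i₁ i₂ i₃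
      refine (i₁.trans (add_le_add_left (i₂.trans (add_le_add_left i₃ _)) _)).trans ?_
      linarith [hng j k, (hsmall j k).2]
  calc (⨅ v' : VSpace R θ', h1Norm (v - v')) ≤ h1Norm (v - v') :=
        ciInf_le ⟨0, by rintro _ ⟨_, rfl⟩; exact h1Norm_nonneg _⟩ (⟨v', hv'⟩ : VSpace R θ')
    _ ≤ _ := hfinal
    _ = _ := by ring
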